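/- **Strings.** Let $\Sigma$ be a finite alphabet that contains two distinct letters $\mathtt 0,\mathtt 1$ and carries an abelian group operation $\oplus$ (for example, bitwise XOR). For strings $X,Y$, let $\delta_E(X,Y)$ denote the edit (Levenshtein) distance, i.e. the minimum number of insertions, deletions and substitutions of single characters that transform $X$ into $Y$. For a pattern $P\in\Sigma^m$, a text $T\in\Sigma^n$ and an integer $k>0$, let $$\mathrm{Occ}^E_k(P,T)=\{\,i\in\{0,\dots,n\} : \delta_E(P,T[i\mathinner{.\,.}j))\le k \text{ for some } j\in\{i,\dots,n\}\,\}.$$ **Quantum query algorithms.** A quantum query algorithm accesses $(P,T)$ only through the oracle $|i,b,w\rangle\mapsto|i,b\oplus S[i],w\rangle$, where $i$ ranges over the positions of $P$ and of $T$, $S[i]$ is the character at position $i$, $b\in\Sigma$, and $w$ is a basis state of a finite-dimensional workspace. It starts in a fixed basis state and alternates between arbitrary input-independent unitaries and queries; after each of the unitaries it performs an input-independent measurement in the standard basis that tells it either to stop with a certain output or to go on. The number of queries used on an input is the least $q$ such that the algorithm stops with certainty after at most $q$ queries ($\infty$ if there is none). The algorithm is correct on an input if it outputs the correct answer with probability at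 least $2/3$. It may depend arbitrarily on $n,m,k$ and $\Sigma$. **Theorem.** There is an absolute constant $c>0$ such that the following holds for all integers $n\ge m>k>0$ and every such $\Sigma$. 1. Every quantum query algorithm that, for $P=\mathtt 0^m$ and all $T\in\{\mathtt 0,\mathtt 1\}^n$, correctly outputs the set $\mathrm{Occ}^E_k(P,T)$ uses at least $c\cdot\frac nm\cdot\sqrt{k(m-k)}$ queries for $P=\mathtt 0^m$ and some $T\in\{\mathtt 0,\mathtt 1\}^n$. 2. Every quantum query algorithm that, for $P=\mathtt 0^m$ and all $T\in\{\mathtt 0,\mathtt 1\}^n$, correctly decides whether $\mathrm{Occ}^E_k(P,T)\ne\varnothing$ uses at least $c\cdot\sqrt{\frac nm}\cdot\sqrt{k(m-k)}$ queries for $P=\mathtt 0^m$ and some $T\in\{\mathtt 0,\mathtt 1\}^n$. In particular, both bounds apply to algorithms that are correct for all patterns $P\in\Sigma^m$ and all texts $T\in\Sigma^n$. -/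

import Mathlib

open scoped Matrix ENNReal

/-! ### Strings, edit distance and `k`-error occurrences -/

/-- `AlignCost X Y c`: there is an alignment of `X` onto `Y` of cost `c`, that is, a way of
transforming `X` into `Y`, read from left to right, with exactly `c` deletions, insertions and
substitutions of single characters (all other characters being matched to equal ones). -/
inductive AlignCost {σ : Type} : List σ → List σ → ℕ → Prop
  | nil : AlignCost [] [] 0
  | delete {X Y : List σ} {c : ℕ} (a : σ) : AlignCost X Y c → AlignCost (a :: X) Y (c + 1)
  | insert {X Y : List σ} {c : ℕ} (b : σ) : AlignCost X Y c → AlignCost X (b :: Y) (c + 1)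
  | substitute {X Y : List σ} {c : ℕ} (a b : σ) : a ≠ b → AlignCost X Y c →
      AlignCost (a :: X) (b :: Y) (c + 1)
  | copy {X Y : List σ} {c : ℕ} (a : σ) : AlignCost X Y c → AlignCost (a :: X) (a :: Y) c

/-- The edit (Levenshtein) distance: the minimum cost of an alignment. -/
noncomputable def editDist {σ : Type} (X Y : List σ) : ℕ := sInf {c : ℕ | AlignCost X Y c}

/-- Some alignment always exists, so `editDist` is a genuine minimum. -/
theorem exists_alignCost {σ : Type} (X Y : List σ) : ∃ c : ℕ, AlignCost X Y c := by
  induction X with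
  | nil =>
    induction Y with
    | nil => exact ⟨0, .nil⟩
    | cons b Y ih => exact ih.imp' (· + 1) fun _ h => .insert b h
  | cons a X ih => exact ih.imp' (· + 1) fun _ h => .delete a h

theorem alignCost_editDist {σ : Type} (X Y : List σ) : AlignCost X Y (editDist X Y) :=
  Nat.sInf_mem (exists_alignCost X Y)

/-- The fragment `T[i..j)`. -/
def fragment {σ : Type} (T : List σ) (i j : ℕ) : List σ := (T.take j).drop i

/-- The set of starting positions `i ∈ [0..n]` of fragments `T[i..j)`, `j ∈ [i..n]`, that are at
edit distance at most `k` from `P`, where `n = |T|`. -/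
def Occ {σ : Type} (k : ℕ) (P T : List σ) : Set ℕ :=
  {i | i ≤ T.length ∧ ∃ j, i ≤ j ∧ j ≤ T.length ∧ editDist P (fragment T i j) ≤ k}

/-! ### Quantum query algorithms -/

/-- Basis states `|i, b, w⟩`: a query position `i : ι`, a query answer register `b : σ`, and a
workspace register with `d` basis states. -/
abbrev QBasis (ι σ : Type) (d : ℕ) : Type := ι × σ × Fin d

/-- A quantum algorithm with oracle access to an input `x : ι → σ` and outputs in `Out`.

Starting from a basis state, it alternates between input-independent unitaries
`unitary 0, unitary 1, …` and queries, `unitary s` being applied after the `s`-th query.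
After `unitary s`, it measures `label s` of the basis state: on the result `some o` it stops
and outputs `o`, on the result `none` it goes on with its next query. (An algorithm with a fixed
number `t` of queries has `label s = none` for `s < t` and no `none` among the `label t`.) -/
structure QueryAlgorithm (ι σ Out : Type) [Fintype ι] [DecidableEq ι] [Fintype σ]
    [DecidableEq σ] where
  d : ℕ
  start : QBasis ι σ d
  unitary : ℕ → Matrix.unitaryGroup (QBasis ι σ d) ℂ
  label : ℕ → QBasis ι σ d → Option Out

/-- The query unitary `|i, b, w⟩ ↦ |i, b + x i, w⟩`. -/
def oracle {ι σ : Type} [AddCommGroup σ] {d : ℕ} (x : ι → σ) (ψ : QBasis ι σ d → ℂ) :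
    QBasis ι σ d → ℂ :=
  fun v => ψ (v.1, v.2.1 - x v.1, v.2.2)

namespace QueryAlgorithm

variable {ι σ Out : Type} [Fintype ι] [DecidableEq ι] [Fintype σ] [DecidableEq σ]

/-- The component of `ψ` on which the algorithm does not stop after its `s`-th query. -/
def running (A : QueryAlgorithm ι σ Out) (s : ℕ) (ψ : QBasis ι σ A.d → ℂ) :
    QBasis ι σ A.d → ℂ :=
  fun v => if (A.label s v).isNone then ψ v else 0

variable [AddCommGroup σ]

/-- The state on input `x` right before the measurement that follows the `s`-th query. It is not
normalized: its squared norm is the probability that the algorithm gets that far. -/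
noncomputable def state (A : QueryAlgorithm ι σ Out) (x : ι → σ) : ℕ → QBasis ι σ A.d → ℂ
  | 0 => (A.unitary 0 : Matrix (QBasis ι σ A.d) (QBasis ι σ A.d) ℂ) *ᵥ Pi.single A.start 1
  | s + 1 => (A.unitary (s + 1) : Matrix (QBasis ι σ A.d) (QBasis ι σ A.d) ℂ) *ᵥ
      oracle x (A.running s (A.state x s))

open Classical in
/-- The probability that the algorithm stops with output `o` on input `x`. -/
noncomputable def outputProb (A : QueryAlgorithm ι σ Out) (x : ι → σ) (o : Out) : ℝ≥0∞ :=
  ∑' s : ℕ, ∑ v : QBasis ι σ A.d,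
    if A.label s v = some o then ENNReal.ofReal (‖A.state x s v‖ ^ 2) else 0

/-- On input `x`, the algorithm certainly stops after at most `q` queries. -/
def StopsWithin (A : QueryAlgorithm ι σ Out) (x : ι → σ) (q : ℕ) : Prop :=
  A.running q (A.state x q) = 0

/-- The number of queries used on input `x`: the least `q` such that the algorithm certainly stops
after at most `q` queries, and `⊤` if there is none. -/
noncomputable def queryCount (A : QueryAlgorithm ι σ Out) (x : ι → σ) : ℕ∞ :=
  ⨅ (q : ℕ) (_ : A.StopsWithin x q), (q : ℕ∞)

end QueryAlgorithm

/-! ### Pattern Matching with Edits with oracle access to the pattern and to the text -/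

section PatternMatching

variable {σ : Type} [Fintype σ] [DecidableEq σ] [AddCommGroup σ] {m n : ℕ}

/-- The input given by a pattern `P` and a text `T`; a query reads a position of either. -/
def pmInput (P : Fin m → σ) (T : Fin n → σ) : Fin m ⊕ Fin n → σ := Sum.elim P T

/-- The algorithm outputs the set of `k`-error occurrences of `P` in `T` with probability
at least `2/3`. -/
def ReportsOcc (A : QueryAlgorithm (Fin m ⊕ Fin n) σ (Set ℕ)) (k : ℕ) (P : Fin m → σ)
    (T : Fin n → σ) : Prop :=
  2 / 3 ≤ A.outputProb (pmInput P T) (Occ k (List.ofFn P) (List.ofFn T))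

open Classical in
/-- The algorithm decides with probability at least `2/3` correctly whether there is a `k`-error
occurrence of `P` in `T`. -/
def DecidesOcc (A : QueryAlgorithm (Fin m ⊕ Fin n) σ Bool) (k : ℕ) (P : Fin m → σ)
    (T : Fin n → σ) : Prop :=
  2 / 3 ≤ A.outputProb (pmInput P T) (decide (Occ k (List.ofFn P) (List.ofFn T)).Nonempty)

/-- All characters of `T` are among `a` and `b`. -/
def IsBinary (a b : σ) (T : Fin n → σ) : Prop := ∀ i, T i = a ∨ T i = b

end PatternMatching

/-! ### The adversary method -/

/-! ### Inner products of amplitude vectors and distinguishability. -/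

section Vectors

variable {α β : Type*} [Fintype α]

/-! For a unary pattern, edit distance amounts to counting zeros. A window of length `m` with at
least `m - k` zeros is an occurrence, and any occurrence yields a window of length `m + k < 2 * m`
with that many zeros. Place about `n / (3 * m)` blocks of length `m` in the text, separated by gaps
of length `2 * m` without zeros, and let each block hold `m - k` zeros or one fewer. No relevant
window meets two blocks, so `Occ` reveals exactly which blocks are full
(`mem_Occ_iff_mem_fullBlocks`), and it is nonempty iff some block is full (`Occ_nonempty_iff`). The
two problems thus contain `N` independent threshold problems and the OR of `N` threshold problems.

These are bounded below by a positive-weight adversary argument (`QueryAlgorithm.adversary_bound`).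
The inner product of the states on two inputs with different answers must fall by a constant,
whereas one query on inputs that differ at one position lowers it by no more than the amplitude on
that position permits. The bound is governed by the largest eigenvalue of the graph of single flips,
and a positive weight with `l * w ≤` (sum over neighbours) certifies an eigenvalue of at least `l`.
With `h = m - k`, a full block has `h` removals and a non-full one has `m + 1 - h = k + 1`
additions. Geometric weights give `l = N √((m - k) (k + 1))`. Weights supported on at most one full
block give `l = √(N (m - k) (k + 1))`. -/

theorem star_mulVec_dotProduct_mulVec_unitary [DecidableEq α] (U : Matrix.unitaryGroup α ℂ)
    (ψ φ : α → ℂ) :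
    star ((U : Matrix α α ℂ) *ᵥ ψ) ⬝ᵥ ((U : Matrix α α ℂ) *ᵥ φ) = star ψ ⬝ᵥ φ := by
  rw [Matrix.star_mulVec, Matrix.dotProduct_mulVec, Matrix.vecMul_vecMul,
    ← Matrix.star_eq_conjTranspose, Matrix.UnitaryGroup.star_mul_self, Matrix.vecMul_one]

theorem star_dotProduct_self_eq (ψ : α → ℂ) :
    star ψ ⬝ᵥ ψ = ((∑ v, ‖ψ v‖ ^ 2 : ℝ) : ℂ) := by
  simp [dotProduct, Complex.conj_mul']

/-- Two families of amplitudes whose squared weights give probability at least `2/3` to disjoint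
events have an inner product bounded away from one. -/
theorem norm_sum_star_mul_le_of_disjoint (I : Finset β) (u w : β → ℂ) (E E' : β → Prop)
    [DecidablePred E] [DecidablePred E'] (hEE : ∀ a, E a → ¬ E' a)
    (hu : ∑ a ∈ I, ‖u a‖ ^ 2 ≤ 1) (hw : ∑ a ∈ I, ‖w a‖ ^ 2 ≤ 1)
    (hE : 2 / 3 ≤ ∑ a ∈ I, if E a then ‖u a‖ ^ 2 else 0)
    (hE' : 2 / 3 ≤ ∑ a ∈ I, if E' a then ‖w a‖ ^ 2 else 0) :
    ‖∑ a ∈ I, star (u a) * w a‖ ≤ 17 / 18 := by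
  -- Disjointness leaves `w` mass at most `1/3` on `E`.
  have hd : ∑ a ∈ I, ((if E a then ‖w a‖ ^ 2 else 0) + if E' a then ‖w a‖ ^ 2 else 0)
      ≤ ∑ a ∈ I, ‖w a‖ ^ 2 := by
    refine Finset.sum_le_sum fun a _ => ?_
    have := hEE a
    have := sq_nonneg ‖w a‖
    by_cases h : E a <;> by_cases h' : E' a <;> simp_all
  rw [Finset.sum_add_distrib] at hd
  -- Weighted AM-GM with coefficients `3/8, 2/3` on `E` and `2/3, 3/8` off it; their product is
  -- `1/4`. The total is at most `25/24 - 7/24 * (2/3 - 1/3) = 17/18`.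
  have hp : ∑ a ∈ I, ‖star (u a) * w a‖ ≤ ∑ a ∈ I, (2 / 3 * ‖u a‖ ^ 2 + 3 / 8 * ‖w a‖ ^ 2
      - 7 / 24 * (if E a then ‖u a‖ ^ 2 else 0) + 7 / 24 * (if E a then ‖w a‖ ^ 2 else 0)) := by
    refine Finset.sum_le_sum fun a _ => ?_
    rw [norm_mul, norm_star]
    split_ifs
    · nlinarith [sq_nonneg (3 * ‖u a‖ - 4 * ‖w a‖)]
    · nlinarith [sq_nonneg (4 * ‖u a‖ - 3 * ‖w a‖)]
  simp only [Finset.sum_add_distrib, Finset.sum_sub_distrib, ← Finset.mul_sum] at hp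
  have := norm_sum_le I fun a => star (u a) * w a
  linarith

end Vectors

/-! ### The effect of one query. -/

section Oracle

variable {ι σ : Type} {d : ℕ}

section Mass

variable [Fintype ι] [DecidableEq ι] [Fintype σ]

/-- The squared norm of the part of `ψ` that queries position `i`. -/
noncomputable def queryMass (i : ι) (ψ : QBasis ι σ d → ℂ) : ℝ :=
  ∑ v, if v.1 = i then ‖ψ v‖ ^ 2 else 0

theorem queryMass_nonneg (i : ι) (ψ : QBasis ι σ d → ℂ) : 0 ≤ queryMass i ψ :=
  Finset.sum_nonneg fun v _ => by split_ifs <;> positivity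

theorem sum_queryMass (ψ : QBasis ι σ d → ℂ) : ∑ i, queryMass i ψ = ∑ v, ‖ψ v‖ ^ 2 := by
  simp only [queryMass]
  rw [Finset.sum_comm]
  simp

end Mass

variable [AddCommGroup σ]

/-- The permutation of the basis states whose pullback is `oracle x`. -/
def oracleEquiv (d : ℕ) (x : ι → σ) : QBasis ι σ d ≃ QBasis ι σ d where
  toFun v := (v.1, v.2.1 - x v.1, v.2.2)
  invFun v := (v.1, v.2.1 + x v.1, v.2.2)
  left_inv v := by simp
  right_inv v := by simp

variable [Fintype ι] [Fintype σ]

theorem star_oracle_dotProduct_oracle (x : ι → σ) (ψ φ : QBasis ι σ d → ℂ) :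
    star (oracle x ψ) ⬝ᵥ oracle x φ = star ψ ⬝ᵥ φ :=
  Equiv.sum_comp (oracleEquiv d x) fun v => star (ψ v) * φ v

variable [DecidableEq ι]

theorem queryMass_oracle (x : ι → σ) (i : ι) (ψ : QBasis ι σ d → ℂ) :
    queryMass i (oracle x ψ) = queryMass i ψ :=
  Equiv.sum_comp (oracleEquiv d x) fun v => if v.1 = i then ‖ψ v‖ ^ 2 else 0

/-- A query changes the inner product of the states on two inputs that agree outside `i` by at most
what the amplitudes of querying `i` allow. -/
theorem mul_norm_sub_oracle_le (x y : ι → σ) (i : ι) (hxy : ∀ j, j ≠ i → x j = y j)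
    (ψ φ : QBasis ι σ d → ℂ) {a b : ℝ} (ha : 0 ≤ a) (hb : 0 ≤ b) :
    a * b * ‖star ψ ⬝ᵥ φ - star (oracle x ψ) ⬝ᵥ oracle y φ‖ ≤
      a ^ 2 * queryMass i ψ + b ^ 2 * queryMass i φ := by
  -- Applying the same oracle to both vectors preserves the inner product, so only the discrepancy
  -- between the two oracles on `φ` remains, and it is supported on queries to `i`.
  have h1 : star ψ ⬝ᵥ φ - star (oracle x ψ) ⬝ᵥ oracle y φ =
      ∑ v, star (oracle x ψ v) * (oracle x φ v - oracle y φ v) := by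
    rw [← star_oracle_dotProduct_oracle x ψ φ]
    simp only [dotProduct, Pi.star_apply, mul_sub, Finset.sum_sub_distrib]
  -- The mass of `φ` is split in halves because the discrepancy is bounded by the norms of both of
  -- its images, under `x` and under `y`.
  have h2 : a ^ 2 * queryMass i ψ + b ^ 2 * queryMass i φ =
      ∑ v : QBasis ι σ d, ((a ^ 2 * if v.1 = i then ‖oracle x ψ v‖ ^ 2 else 0)
        + (b ^ 2 / 2 * (if v.1 = i then ‖oracle x φ v‖ ^ 2 else 0)
        + b ^ 2 / 2 * (if v.1 = i then ‖oracle y φ v‖ ^ 2 else 0))) := by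
    simp only [Finset.sum_add_distrib, ← Finset.mul_sum]
    change _ = a ^ 2 * queryMass i (oracle x ψ) + (b ^ 2 / 2 * queryMass i (oracle x φ)
      + b ^ 2 / 2 * queryMass i (oracle y φ))
    simp only [queryMass_oracle]
    ring
  rw [h1, h2]
  refine (mul_le_mul_of_nonneg_left (norm_sum_le _ _) (mul_nonneg ha hb)).trans ?_
  rw [Finset.mul_sum]
  refine Finset.sum_le_sum fun v _ => ?_
  rw [norm_mul, norm_star]
  split_ifs with hv
  · have h3 : a * b * (‖oracle x ψ v‖ * ‖oracle x φ v - oracle y φ v‖) ≤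
        a * b * (‖oracle x ψ v‖ * (‖oracle x φ v‖ + ‖oracle y φ v‖)) := by
      gcongr
      exact norm_sub_le _ _
    nlinarith [sq_nonneg (a * ‖oracle x ψ v‖ - b * ‖oracle x φ v‖),
      sq_nonneg (a * ‖oracle x ψ v‖ - b * ‖oracle y φ v‖)]
  · have : oracle x φ v = oracle y φ v := by simp [oracle, hxy _ hv]
    simp [this]

end Oracle

/-! ### Loss of inner product during a run, and the adversary bound. -/

namespace QueryAlgorithm

variable {ι σ Out : Type} [Fintype ι] [DecidableEq ι] [Fintype σ] [DecidableEq σ]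
  (A : QueryAlgorithm ι σ Out)

/-- The basis states, together with the number of queries made so far, in which the algorithm stops
after at most `q` queries. -/
def stops (q : ℕ) : Finset (ℕ × QBasis ι σ A.d) :=
  (Finset.range (q + 1) ×ˢ Finset.univ).filter fun a => (A.label a.1 a.2).isSome

theorem sum_stops {M : Type*} [AddCommMonoid M] (q : ℕ) (f : ℕ → QBasis ι σ A.d → M) :
    ∑ a ∈ A.stops q, f a.1 a.2 =
      ∑ s ∈ Finset.range (q + 1), ∑ v, if (A.label s v).isSome then f s v else 0 := by
  rw [stops, Finset.sum_filter, Finset.sum_product]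

variable [AddCommGroup σ]

/-- The running component of the state on input `x` after `s` queries. -/
noncomputable def runningState (x : ι → σ) (s : ℕ) : QBasis ι σ A.d → ℂ :=
  A.running s (A.state x s)

theorem state_succ (x : ι → σ) (s : ℕ) : A.state x (s + 1) =
    (A.unitary (s + 1) : Matrix (QBasis ι σ A.d) (QBasis ι σ A.d) ℂ) *ᵥ
      oracle x (A.runningState x s) := rfl

variable {A} in
theorem StopsWithin.succ {x : ι → σ} {q : ℕ} (h : A.StopsWithin x q) :
    A.state x (q + 1) = 0 := by
  have h' : A.runningState x q = 0 := h
  have h0 : oracle x (0 : QBasis ι σ A.d → ℂ) = 0 := rfl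
  rw [state_succ, h', h0, Matrix.mulVec_zero]

variable {A} in
theorem StopsWithin.mono {x : ι → σ} {q q' : ℕ} (h : A.StopsWithin x q) (hq : q ≤ q') :
    A.StopsWithin x q' := by
  induction q', hq using Nat.le_induction with
  | base => exact h
  | succ r _ ih =>
    unfold StopsWithin
    rw [ih.succ]
    funext v
    simp [running]

variable {A} in
theorem StopsWithin.state_eq_zero {x : ι → σ} {q s : ℕ} (h : A.StopsWithin x q) (hs : q < s) :
    A.state x s = 0 := by
  obtain ⟨r, rfl⟩ : ∃ r, s = r + 1 := ⟨s - 1, by omega⟩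
  exact (h.mono (by omega : q ≤ r)).succ

/-- The change of the inner product of the states on `x` and `y` in the query number `s + 1`. -/
noncomputable def queryLoss (x y : ι → σ) (s : ℕ) : ℂ :=
  star (A.runningState x s) ⬝ᵥ A.runningState y s -
    star (oracle x (A.runningState x s)) ⬝ᵥ oracle y (A.runningState y s)

theorem star_state_dotProduct_state (x y : ι → σ) (s : ℕ) :
    star (A.state x s) ⬝ᵥ A.state y s =
      (∑ v, if (A.label s v).isSome then star (A.state x s v) * A.state y s v else 0) +
        star (A.runningState x s) ⬝ᵥ A.runningState y s := by
  simp only [dotProduct, ← Finset.sum_add_distrib]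
  refine Finset.sum_congr rfl fun v _ => ?_
  cases h : A.label s v <;> simp [runningState, running, h]

theorem star_state_succ_dotProduct_state_succ (x y : ι → σ) (s : ℕ) :
    star (A.state x (s + 1)) ⬝ᵥ A.state y (s + 1) =
      star (A.runningState x s) ⬝ᵥ A.runningState y s - A.queryLoss x y s := by
  rw [state_succ, state_succ, star_mulVec_dotProduct_mulVec_unitary, queryLoss]
  ring

/-- Conservation law: both runs begin in the same unit vector, unitaries preserve inner products,
measurements split them into a stopped and a running part, and only queries change them. -/
theorem sum_stops_add_running (x y : ι → σ) (q : ℕ) :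
    (∑ a ∈ A.stops q, star (A.state x a.1 a.2) * A.state y a.1 a.2) +
      star (A.runningState x q) ⬝ᵥ A.runningState y q +
      ∑ s ∈ Finset.range q, A.queryLoss x y s = 1 := by
  rw [A.sum_stops q fun s v => star (A.state x s v) * A.state y s v]
  induction q with
  | zero =>
    simp only [Finset.range_zero, Finset.sum_empty, add_zero, zero_add, Finset.range_one,
      Finset.sum_singleton]
    rw [← star_state_dotProduct_state]
    change star (_ *ᵥ _) ⬝ᵥ (_ *ᵥ _) = _
    rw [star_mulVec_dotProduct_mulVec_unitary]
    simp
  | succ q ih =>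
    rw [Finset.sum_range_succ _ (q + 1), Finset.sum_range_succ (fun s => A.queryLoss x y s)]
    have h1 := A.star_state_dotProduct_state x y (q + 1)
    have h2 := A.star_state_succ_dotProduct_state_succ x y q
    linear_combination ih - h1 + h2

theorem queryLoss_self (x : ι → σ) (s : ℕ) : A.queryLoss x x s = 0 := by
  rw [queryLoss, star_oracle_dotProduct_oracle, sub_self]

/-- The conservation law for equal inputs, where queries lose nothing: the probabilities of having
stopped and of still running add up to one. -/
theorem sum_stops_norm_sq_add_running (x : ι → σ) (q : ℕ) :
    ∑ a ∈ A.stops q, ‖A.state x a.1 a.2‖ ^ 2 + ∑ v, ‖A.runningState x q v‖ ^ 2 = 1 := by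
  have h := A.sum_stops_add_running x x q
  rw [star_dotProduct_self_eq] at h
  simp only [queryLoss_self, Finset.sum_const_zero, add_zero, Complex.star_def,
    Complex.conj_mul'] at h
  exact_mod_cast h

theorem sum_stops_norm_sq_le_one (x : ι → σ) (q : ℕ) :
    ∑ a ∈ A.stops q, ‖A.state x a.1 a.2‖ ^ 2 ≤ 1 := by
  rw [← A.sum_stops_norm_sq_add_running x q]
  exact le_add_of_nonneg_right (Finset.sum_nonneg fun v _ => by positivity)

theorem sum_norm_sq_runningState_le_one (x : ι → σ) (q : ℕ) :
    ∑ v, ‖A.runningState x q v‖ ^ 2 ≤ 1 := by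
  rw [← A.sum_stops_norm_sq_add_running x q]
  exact le_add_of_nonneg_left (Finset.sum_nonneg fun v _ => by positivity)

open Classical in
-- The state vanishes after `q` queries, so the infinite series for the output probability is a
-- finite sum.
theorem two_thirds_le_sum_stops {x : ι → σ} {q : ℕ} (h : A.StopsWithin x q) {o : Out}
    (ho : 2 / 3 ≤ A.outputProb x o) :
    2 / 3 ≤ ∑ a ∈ A.stops q,
      if A.label a.1 a.2 = some o then ‖A.state x a.1 a.2‖ ^ 2 else 0 := by
  rw [A.sum_stops q fun s v => if A.label s v = some o then ‖A.state x s v‖ ^ 2 else 0]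
  have h1 : A.outputProb x o = ENNReal.ofReal (∑ s ∈ Finset.range (q + 1), ∑ v,
      if A.label s v = some o then ‖A.state x s v‖ ^ 2 else 0) := by
    rw [outputProb, tsum_eq_sum (s := Finset.range (q + 1)), ENNReal.ofReal_sum_of_nonneg]
    · refine Finset.sum_congr rfl fun s _ => ?_
      rw [ENNReal.ofReal_sum_of_nonneg]
      · refine Finset.sum_congr rfl fun v _ => ?_
        split_ifs <;> simp
      · intro v _
        split_ifs <;> positivity
    · intro s _
      refine Finset.sum_nonneg fun v _ => ?_
      split_ifs <;> positivity
    · intro s hs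
      have hs' : q < s := by simpa using hs
      simp [h.state_eq_zero hs']
  have h2 : (2 / 3 : ℝ≥0∞) = ENNReal.ofReal (2 / 3) := by
    rw [ENNReal.ofReal_div_of_pos (by norm_num)]
    simp
  rw [h1, h2, ENNReal.ofReal_le_ofReal_iff'] at ho
  refine (ho.resolve_right (by norm_num)).trans (le_of_eq ?_)
  refine Finset.sum_congr rfl fun s _ => Finset.sum_congr rfl fun v _ => ?_
  cases hl : A.label s v <;> simp

/-- Two inputs with different answers have to be told apart by the queries. -/
theorem one_le_sum_norm_queryLoss {x y : ι → σ} {q : ℕ} (hx : A.StopsWithin x q)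
    {o o' : Out} (hoo : o ≠ o') (ho : 2 / 3 ≤ A.outputProb x o)
    (ho' : 2 / 3 ≤ A.outputProb y o') (hy : A.StopsWithin y q) :
    1 / 18 ≤ ∑ s ∈ Finset.range q, ‖A.queryLoss x y s‖ := by
  classical
  have h1 := norm_sum_star_mul_le_of_disjoint (A.stops q) (fun a => A.state x a.1 a.2)
    (fun a => A.state y a.1 a.2) (fun a => A.label a.1 a.2 = some o)
    (fun a => A.label a.1 a.2 = some o')
    (fun a h h' => hoo (Option.some_injective _ (h.symm.trans h')))
    (A.sum_stops_norm_sq_le_one x q) (A.sum_stops_norm_sq_le_one y q)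
    (A.two_thirds_le_sum_stops hx ho) (A.two_thirds_le_sum_stops hy ho')
  have h2 := A.sum_stops_add_running x y q
  have h3 : A.runningState y q = 0 := hy
  rw [h3, dotProduct_zero, add_zero] at h2
  have h4 := norm_add_le (∑ a ∈ A.stops q, star (A.state x a.1 a.2) * A.state y a.1 a.2)
    (∑ s ∈ Finset.range q, A.queryLoss x y s)
  rw [h2, norm_one] at h4
  have h5 := norm_sum_le (Finset.range q) fun s => A.queryLoss x y s
  linarith

/-- The adversary bound for inputs that are connected by flips of single positions: a positive
weight function whose sum over the neighbours of each input is at least `l` times its value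
at the input forces at least `l / 36` queries. -/
theorem adversary_bound {X κ : Type*} [Fintype X] [Fintype κ] (input : X → ι → σ)
    (e : κ → ι) (he : Function.Injective e) (flip : κ → X → X)
    (hflip : ∀ p, Function.Involutive (flip p))
    (hinput : ∀ p x j, j ≠ e p → input (flip p x) j = input x j)
    (answer : X → Out) (w : X → ℝ) (hw : ∀ x, 0 ≤ w x) (hpos : ∃ x, 0 < w x)
    (hne : ∀ p x, 0 < w x → 0 < w (flip p x) → answer x ≠ answer (flip p x))
    {l : ℝ} (hl : ∀ x, l * w x ≤ ∑ p, w (flip p x))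
    (hA : ∀ x, 2 / 3 ≤ A.outputProb (input x) (answer x))
    {q : ℕ} (hq : ∀ x, A.StopsWithin (input x) q) : l ≤ 36 * q := by
  let R : X → ℕ → QBasis ι σ A.d → ℂ := fun x => A.runningState (input x)
  have hpair : ∀ p x, w x * w (flip p x) * (1 / 18) ≤ ∑ s ∈ Finset.range q,
      (w x ^ 2 * queryMass (e p) (R x s) +
        w (flip p x) ^ 2 * queryMass (e p) (R (flip p x) s)) := by
    intro p x
    -- Pairs involving zero weight are trivial; they must be set aside because their answers may
    -- coincide.
    rcases (hw x).eq_or_lt with h0 | h0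
    · rw [← h0, zero_mul, zero_mul]
      refine Finset.sum_nonneg fun s _ => ?_
      exact add_nonneg (mul_nonneg (sq_nonneg _) (queryMass_nonneg _ _))
        (mul_nonneg (sq_nonneg _) (queryMass_nonneg _ _))
    rcases (hw (flip p x)).eq_or_lt with h1 | h1
    · rw [← h1, mul_zero, zero_mul]
      refine Finset.sum_nonneg fun s _ => ?_
      exact add_nonneg (mul_nonneg (sq_nonneg _) (queryMass_nonneg _ _))
        (mul_nonneg (sq_nonneg _) (queryMass_nonneg _ _))
    refine (mul_le_mul_of_nonneg_left (A.one_le_sum_norm_queryLoss (hq x) (hne p x h0 h1) (hA x)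
      (hA _) (hq _)) (by positivity)).trans ?_
    rw [Finset.mul_sum]
    exact Finset.sum_le_sum fun s _ => mul_norm_sub_oracle_le _ _ _
      (fun j hj => (hinput p x j hj).symm) _ _ h0.le h1.le
  -- Distinct flips touch distinct positions, so their query masses are parts of a total of at most
  -- one.
  have hmass : ∀ s x, ∑ p, queryMass (e p) (R x s) ≤ 1 := by
    intro s x
    refine le_trans ?_ (A.sum_norm_sq_runningState_le_one (input x) s)
    rw [← sum_queryMass]
    refine (Finset.sum_map Finset.univ ⟨e, he⟩ fun i => queryMass i (R x s)).symm.trans_le ?_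
    exact Finset.sum_le_sum_of_subset_of_nonneg (Finset.subset_univ _)
      fun i _ _ => queryMass_nonneg _ _
  have hstep : ∀ s, ∑ p, ∑ x, (w x ^ 2 * queryMass (e p) (R x s) +
        w (flip p x) ^ 2 * queryMass (e p) (R (flip p x) s)) ≤ 2 * ∑ x, w x ^ 2 := by
    intro s
    -- Each flip permutes the inputs, so both summands have the same total.
    have h1 : ∀ p, ∑ x, (w x ^ 2 * queryMass (e p) (R x s) +
        w (flip p x) ^ 2 * queryMass (e p) (R (flip p x) s)) =
        2 * ∑ x, w x ^ 2 * queryMass (e p) (R x s) := by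
      intro p
      rw [Finset.sum_add_distrib, two_mul]
      congr 1
      exact Equiv.sum_comp (hflip p).toPerm fun x => w x ^ 2 * queryMass (e p) (R x s)
    simp only [h1, ← Finset.mul_sum]
    rw [Finset.sum_comm]
    refine mul_le_mul_of_nonneg_left (Finset.sum_le_sum fun x _ => ?_) zero_le_two
    rw [← Finset.mul_sum]
    exact mul_le_of_le_one_right (sq_nonneg _) (hmass s x)
  have hW : 0 < ∑ x, w x ^ 2 := by
    obtain ⟨x, hx⟩ := hpos
    exact Finset.sum_pos' (fun _ _ => sq_nonneg _) ⟨x, Finset.mem_univ _, pow_pos hx 2⟩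
  have h1 : l * (∑ x, w x ^ 2) ≤ ∑ p, ∑ x, w x * w (flip p x) := by
    rw [Finset.sum_comm, Finset.mul_sum]
    refine Finset.sum_le_sum fun x _ => ?_
    rw [← Finset.mul_sum]
    nlinarith [mul_le_mul_of_nonneg_left (hl x) (hw x)]
  have h2 : (∑ p, ∑ x, w x * w (flip p x)) * (1 / 18) ≤ q * (2 * ∑ x, w x ^ 2) := by
    simp only [Finset.sum_mul]
    refine (Finset.sum_le_sum fun p _ => Finset.sum_le_sum fun x _ => hpair p x).trans ?_
    simp only [Finset.sum_comm (t := Finset.range q)]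
    refine (Finset.sum_le_sum fun s _ => hstep s).trans ?_
    simp
  refine le_of_mul_le_mul_right ?_ hW
  linarith

/-- An algorithm whose query counts are all below `b` stops within a common number of queries below
`b`. -/
theorem exists_stopsWithin_of_queryCount_lt {X : Type*} [Finite X] [Nonempty X]
    (input : X → ι → σ) {b : ℝ}
    (h : ∀ x, (A.queryCount (input x) : ℝ≥0∞) < ENNReal.ofReal b) :
    ∃ q : ℕ, (q : ℝ) < b ∧ ∀ x, A.StopsWithin (input x) q := by
  have h1 : ∀ x, ∃ q : ℕ, (q : ℝ) < b ∧ A.StopsWithin (input x) q := by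
    intro x
    have hx := h x
    generalize hc : A.queryCount (input x) = c at hx
    cases c with
    | top => simp at hx
    | coe c =>
      -- Strictness against `c + 1` extracts an actual stopping time from the infimum.
      have hlt : A.queryCount (input x) < ((c + 1 : ℕ) : ℕ∞) := by
        rw [hc]
        exact_mod_cast c.lt_succ_self
      simp only [queryCount, iInf_lt_iff] at hlt
      obtain ⟨q, hq, hqc⟩ := hlt
      have hcb : (c : ℝ) < b := by
        rw [ENNReal.lt_ofReal_iff_toReal_lt (by simp)] at hx
        simpa using hx
      have hqc' : q ≤ c := Nat.lt_succ_iff.mp (by exact_mod_cast hqc)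
      exact ⟨q, lt_of_le_of_lt (by exact_mod_cast hqc') hcb, hq⟩
  choose f hf hs using h1
  obtain ⟨x, hx⟩ := Finite.exists_max f
  exact ⟨f x, hf x, fun y => (hs y).mono (hx y)⟩

end QueryAlgorithm

/-! ### Sets close to a threshold in each of several blocks -/

section Blocks

variable {κ : Type} [DecidableEq κ] {N : ℕ}

/-- `Z` lies in the union of the blocks, and has `h` or `h - 1` elements in each of them. -/
def NearThreshold (B : Fin N → Finset κ) (h : ℕ) (Z : Finset κ) : Prop :=
  (∀ p ∈ Z, ∃ j, p ∈ B j) ∧ ∀ j, (Z ∩ B j).card = h ∨ (Z ∩ B j).card + 1 = h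

/-- The blocks of which `Z` contains exactly `h` elements. -/
def fullBlocks (B : Fin N → Finset κ) (h : ℕ) (Z : Finset κ) : Finset (Fin N) :=
  Finset.univ.filter fun j => (Z ∩ B j).card = h

/-- Adds `p` to `Z` or removes it from `Z`. -/
def flipElem (p : κ) (Z : Finset κ) : Finset κ := symmDiff Z {p}

theorem flipElem_involutive (p : κ) : Function.Involutive (flipElem p) :=
  fun Z => by rw [flipElem, flipElem, symmDiff_assoc, symmDiff_self, symmDiff_bot]

theorem mem_flipElem_of_ne {p i : κ} (hi : i ≠ p) (Z : Finset κ) :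
    i ∈ flipElem p Z ↔ i ∈ Z := by
  simp [flipElem, Finset.mem_symmDiff, hi]

theorem flipElem_of_mem {p : κ} {Z : Finset κ} (hp : p ∈ Z) : flipElem p Z = Z.erase p := by
  ext i
  by_cases hi : i = p <;> simp [flipElem, Finset.mem_symmDiff, hi, hp]

theorem flipElem_of_notMem {p : κ} {Z : Finset κ} (hp : p ∉ Z) :
    flipElem p Z = insert p Z := by
  ext i
  by_cases hi : i = p <;> simp [flipElem, Finset.mem_symmDiff, hi, hp]

theorem flipElem_inter_of_notMem {p : κ} {C : Finset κ} (hp : p ∉ C) (Z : Finset κ) :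
    flipElem p Z ∩ C = Z ∩ C := by
  ext i
  by_cases hi : i = p
  · simp [hi, hp]
  · simp [mem_flipElem_of_ne hi]

theorem card_flipElem_inter_of_mem {p : κ} {C Z : Finset κ} (hp : p ∈ C) (hZ : p ∈ Z) :
    (flipElem p Z ∩ C).card + 1 = (Z ∩ C).card := by
  rw [flipElem_of_mem hZ, Finset.erase_inter,
    Finset.card_erase_add_one (Finset.mem_inter.mpr ⟨hZ, hp⟩)]

theorem card_flipElem_inter_of_notMem {p : κ} {C Z : Finset κ} (hp : p ∈ C) (hZ : p ∉ Z) :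
    (flipElem p Z ∩ C).card = (Z ∩ C).card + 1 := by
  rw [flipElem_of_notMem hZ, Finset.insert_inter_of_mem hp,
    Finset.card_insert_of_notMem fun h => hZ (Finset.mem_inter.mp h).1]

variable {B : Fin N → Finset κ} {h : ℕ} {Z : Finset κ}

theorem mem_fullBlocks {j : Fin N} : j ∈ fullBlocks B h Z ↔ (Z ∩ B j).card = h := by
  simp [fullBlocks]

/-- The two ways of moving from one nearly full set to another by a flip. -/
theorem NearThreshold.flipElem_cases (hZ : NearThreshold B h Z) {p : κ}
    (hp : NearThreshold B h (flipElem p Z)) :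
    ∃ j, p ∈ B j ∧ ((j ∈ fullBlocks B h Z ∧ p ∈ Z) ∨ (j ∉ fullBlocks B h Z ∧ p ∉ Z)) := by
  simp only [mem_fullBlocks]
  by_cases hpZ : p ∈ Z
  · obtain ⟨j, hj⟩ := hZ.1 p hpZ
    have := card_flipElem_inter_of_mem hj hpZ
    have := hZ.2 j
    have := hp.2 j
    exact ⟨j, hj, Or.inl ⟨by omega, hpZ⟩⟩
  · obtain ⟨j, hj⟩ := hp.1 p (by simp [flipElem_of_notMem hpZ])
    have := card_flipElem_inter_of_notMem hj hpZ
    have := hZ.2 j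
    have := hp.2 j
    exact ⟨j, hj, Or.inr ⟨by omega, hpZ⟩⟩

theorem NearThreshold.flipElem_full (hB : Pairwise fun j j' => Disjoint (B j) (B j'))
    (hZ : NearThreshold B h Z) {p : κ} {j : Fin N} (hp : p ∈ B j) (hpZ : p ∈ Z)
    (hj : j ∈ fullBlocks B h Z) :
    NearThreshold B h (flipElem p Z) ∧
      fullBlocks B h (flipElem p Z) = (fullBlocks B h Z).erase j := by
  have hne : ∀ j', j' ≠ j → p ∉ B j' := fun j' hj' hp' =>
    Finset.disjoint_left.mp (hB hj') hp' hp
  have hc := card_flipElem_inter_of_mem hp hpZ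
  rw [mem_fullBlocks] at hj
  refine ⟨⟨fun q hq => hZ.1 q ?_, fun j' => ?_⟩, ?_⟩
  · rw [flipElem_of_mem hpZ] at hq
    exact Finset.mem_of_mem_erase hq
  · by_cases hjj : j' = j
    · subst hjj
      omega
    · rw [flipElem_inter_of_notMem (hne j' hjj)]
      exact hZ.2 j'
  · ext j'
    rw [Finset.mem_erase, mem_fullBlocks, mem_fullBlocks]
    by_cases hjj : j' = j
    · subst hjj
      simp only [ne_eq, not_true_eq_false, false_and, iff_false]
      omega
    · simp [flipElem_inter_of_notMem (hne j' hjj), hjj]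

theorem NearThreshold.flipElem_not_full (hB : Pairwise fun j j' => Disjoint (B j) (B j'))
    (hZ : NearThreshold B h Z) {p : κ} {j : Fin N} (hp : p ∈ B j) (hpZ : p ∉ Z)
    (hj : j ∉ fullBlocks B h Z) :
    NearThreshold B h (flipElem p Z) ∧
      fullBlocks B h (flipElem p Z) = insert j (fullBlocks B h Z) := by
  have hne : ∀ j', j' ≠ j → p ∉ B j' := fun j' hj' hp' =>
    Finset.disjoint_left.mp (hB hj') hp' hp
  have hc := card_flipElem_inter_of_notMem hp hpZ
  have hZj := hZ.2 j
  rw [mem_fullBlocks] at hj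
  refine ⟨⟨fun q hq => ?_, fun j' => ?_⟩, ?_⟩
  · rw [flipElem_of_notMem hpZ, Finset.mem_insert] at hq
    rcases hq with rfl | hq
    · exact ⟨j, hp⟩
    · exact hZ.1 q hq
  · by_cases hjj : j' = j
    · subst hjj
      omega
    · rw [flipElem_inter_of_notMem (hne j' hjj)]
      exact hZ.2 j'
  · ext j'
    rw [Finset.mem_insert, mem_fullBlocks, mem_fullBlocks]
    by_cases hjj : j' = j
    · subst hjj
      simp only [true_or, iff_true]
      omega
    · simp [flipElem_inter_of_notMem (hne j' hjj), hjj]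

open Classical in
/-- The weight `w a` for the nearly full sets with `a` full blocks. -/
noncomputable def blockWeight (B : Fin N → Finset κ) (h : ℕ) (w : ℕ → ℝ) (Z : Finset κ) : ℝ :=
  if NearThreshold B h Z then w (fullBlocks B h Z).card else 0

theorem blockWeight_nonneg {w : ℕ → ℝ} (hw : ∀ a, 0 ≤ w a) : 0 ≤ blockWeight B h w Z := by
  unfold blockWeight
  split_ifs
  exacts [hw _, le_rfl]

theorem nearThreshold_of_blockWeight_pos {w : ℕ → ℝ} (hZ : 0 < blockWeight B h w Z) :
    NearThreshold B h Z ∧ 0 < w (fullBlocks B h Z).card := by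
  unfold blockWeight at hZ
  split_ifs at hZ with hn
  exacts [⟨hn, hZ⟩, absurd hZ (lt_irrefl 0)]

/-- A full block offers `h` removals; a non-full one, with `h - 1` elements, offers `m - (h - 1)`
additions. Disjointness of the blocks makes these flips distinct. The truncated `card - 1` at zero
is harmless, as its factor is zero. -/
theorem sum_blockWeight_flipElem_ge [Fintype κ]
    (hB : Pairwise fun j j' => Disjoint (B j) (B j')) {m : ℕ} (hm : ∀ j, (B j).card = m)
    (hZ : NearThreshold B h Z) {w : ℕ → ℝ} (hw : ∀ a, 0 ≤ w a) :
    (fullBlocks B h Z).card * (h * w ((fullBlocks B h Z).card - 1)) +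
      (N - (fullBlocks B h Z).card : ℝ) * ((m + 1 - h) * w ((fullBlocks B h Z).card + 1)) ≤
      ∑ p, blockWeight B h w (flipElem p Z) := by
  set F := fullBlocks B h Z with hF
  have hblock : ∀ j, (if j ∈ F then h * w (F.card - 1) else (m + 1 - h) * w (F.card + 1)) ≤
      ∑ p ∈ B j, blockWeight B h w (flipElem p Z) := by
    intro j
    split_ifs with hj
    · have hcard : (Z ∩ B j).card = h := mem_fullBlocks.mp hj
      refine le_trans ?_ (Finset.sum_le_sum_of_subset_of_nonneg Finset.inter_subset_right
        fun p _ _ => blockWeight_nonneg hw : ∑ p ∈ Z ∩ B j, blockWeight B h w (flipElem p Z) ≤ _)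
      rw [Finset.sum_congr rfl (g := fun _ => w (F.card - 1)), Finset.sum_const, hcard,
        nsmul_eq_mul]
      intro p hp
      rw [Finset.mem_inter] at hp
      obtain ⟨h1, h2⟩ := hZ.flipElem_full hB hp.2 hp.1 hj
      rw [blockWeight, if_pos h1, h2, Finset.card_erase_of_mem hj]
    · have hcard : (B j \ Z).card + h = m + 1 := by
        have h1 := Finset.card_sdiff_add_card_inter (B j) Z
        rw [Finset.inter_comm, hm] at h1
        have h2 := hZ.2 j
        rw [hF, mem_fullBlocks] at hj
        omega
      refine le_trans ?_ (Finset.sum_le_sum_of_subset_of_nonneg Finset.sdiff_subset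
        fun p _ _ => blockWeight_nonneg hw : ∑ p ∈ B j \ Z, blockWeight B h w (flipElem p Z) ≤ _)
      rw [Finset.sum_congr rfl (g := fun _ => w (F.card + 1)), Finset.sum_const, nsmul_eq_mul]
      · refine le_of_eq (congrArg (· * w (F.card + 1)) ?_)
        rw [sub_eq_iff_eq_add]
        exact_mod_cast hcard.symm
      intro p hp
      rw [Finset.mem_sdiff] at hp
      obtain ⟨h1, h2⟩ := hZ.flipElem_not_full hB hp.1 hp.2 hj
      rw [blockWeight, if_pos h1, h2, Finset.card_insert_of_notMem hj]
  have h1 : ∑ j, ∑ p ∈ B j, blockWeight B h w (flipElem p Z) ≤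
      ∑ p, blockWeight B h w (flipElem p Z) := by
    rw [← Finset.sum_biUnion fun j _ j' _ hjj => hB hjj]
    exact Finset.sum_le_sum_of_subset_of_nonneg (Finset.subset_univ _)
      fun p _ _ => blockWeight_nonneg hw
  refine le_trans (le_of_eq ?_) ((Finset.sum_le_sum fun j _ => hblock j).trans h1)
  rw [Finset.sum_ite, Finset.sum_const, Finset.sum_const, nsmul_eq_mul, nsmul_eq_mul,
    Finset.filter_mem_eq_inter, Finset.univ_inter, Finset.filter_not, Finset.filter_mem_eq_inter,
    Finset.univ_inter, Finset.card_univ_sdiff, Nat.cast_sub (Finset.card_le_univ F)]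
  simp

theorem exists_nearThreshold_fullBlocks_eq_empty
    (hB : Pairwise fun j j' => Disjoint (B j) (B j')) (hh : 0 < h) (hm : ∀ j, h ≤ (B j).card) :
    ∃ Z, NearThreshold B h Z ∧ fullBlocks B h Z = ∅ := by
  have hC : ∀ j, ∃ C ⊆ B j, C.card = h - 1 := fun j =>
    Finset.exists_subset_card_eq (by have := hm j; omega)
  choose C hCB hCh using hC
  have hcard : ∀ j, ((Finset.univ.biUnion C ∩ B j).card) + 1 = h := by
    intro j
    have : Finset.univ.biUnion C ∩ B j = C j := by
      ext p
      simp only [Finset.mem_inter, Finset.mem_biUnion, Finset.mem_univ, true_and]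
      refine ⟨?_, fun hp => ⟨⟨j, hp⟩, hCB j hp⟩⟩
      rintro ⟨⟨j', hj'⟩, hp⟩
      by_cases hjj : j' = j
      · exact hjj ▸ hj'
      · exact absurd hp (Finset.disjoint_left.mp (hB hjj) (hCB j' hj'))
    rw [this, hCh]
    omega
  refine ⟨Finset.univ.biUnion C, ⟨fun p hp => ?_, fun j => Or.inr (hcard j)⟩, ?_⟩
  · obtain ⟨j, -, hj⟩ := Finset.mem_biUnion.mp hp
    exact ⟨j, hCB j hj⟩
  · refine Finset.eq_empty_of_forall_notMem fun j hj => ?_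
    have := hcard j
    rw [mem_fullBlocks] at hj
    omega

/-- Weights for telling all blocks apart. -/
theorem mul_blockWeight_pow_le_sum [Fintype κ]
    (hB : Pairwise fun j j' => Disjoint (B j) (B j')) {m : ℕ} (hm : ∀ j, (B j).card = m)
    (hh : 0 < h) (hhm : h ≤ m) (Z : Finset κ) :
    N * √(h * (m + 1 - h : ℝ)) * blockWeight B h (fun a => (√h / √(m + 1 - h : ℝ)) ^ a) Z ≤
      ∑ p, blockWeight B h (fun a => (√h / √(m + 1 - h : ℝ)) ^ a) (flipElem p Z) := by
  have hh' : (0 : ℝ) < h := by exact_mod_cast hh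
  have hhm' : (0 : ℝ) < m + 1 - h := by
    have : (h : ℝ) ≤ m := by exact_mod_cast hhm
    linarith
  set s : ℝ := √h / √(m + 1 - h : ℝ) with hs
  have hu := Real.sqrt_pos.mpr hh'
  have hv := Real.sqrt_pos.mpr hhm'
  have hs0 : 0 < s := div_pos hu hv
  have hw : ∀ a : ℕ, 0 ≤ s ^ a := fun a => by positivity
  by_cases hZ : NearThreshold B h Z
  · refine le_trans (le_of_eq ?_) (sum_blockWeight_flipElem_ge hB hm hZ hw)
    rw [blockWeight, if_pos hZ]
    generalize (fullBlocks B h Z).card = a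
    -- The ratio `s` is chosen so that full and non-full blocks contribute equally, each `√(h (m + 1
    -- - h))` times the current weight.
    have h1 : (m + 1 - h : ℝ) * s = √(h * (m + 1 - h : ℝ)) := by
      rw [Real.sqrt_mul hh'.le, hs]
      nth_rw 1 [← Real.mul_self_sqrt hhm'.le]
      field_simp
    have h2 : (h : ℝ) = √(h * (m + 1 - h : ℝ)) * s := by
      rw [Real.sqrt_mul hh'.le, hs]
      nth_rw 1 [← Real.mul_self_sqrt hh'.le]
      field_simp
    cases a with
    | zero =>
      simp only [pow_zero, Nat.cast_zero, zero_mul, zero_add, pow_one, sub_zero, mul_one]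
      rw [h1]
    | succ a =>
      rw [pow_succ s (a + 1)]
      simp only [Nat.add_sub_cancel]
      push_cast
      linear_combination (-((a : ℝ) + 1) * s ^ a) * h2 - (N - (a + 1 : ℝ)) * s ^ (a + 1) * h1
  · rw [blockWeight, if_neg hZ, mul_zero]
    exact Finset.sum_nonneg fun p _ => blockWeight_nonneg hw

/-- Weights for telling whether some block is full. -/
theorem mul_blockWeight_le_one_le_sum [Fintype κ]
    (hB : Pairwise fun j j' => Disjoint (B j) (B j')) {m : ℕ} (hm : ∀ j, (B j).card = m)
    (Z : Finset κ) {l s : ℝ} (hs : 0 ≤ s) (hl : l = N * (m + 1 - h) * s) (hl' : l * s = h) :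
    l * blockWeight B h (fun a => if a = 0 then 1 else if a = 1 then s else 0) Z ≤
      ∑ p, blockWeight B h (fun a => if a = 0 then 1 else if a = 1 then s else 0)
        (flipElem p Z) := by
  have hw : ∀ a : ℕ, 0 ≤ (if a = 0 then 1 else if a = 1 then s else 0 : ℝ) := fun a => by
    split_ifs <;> simp [hs]
  have h0 : 0 ≤ ∑ p, blockWeight B h (fun a => if a = 0 then 1 else if a = 1 then s else 0)
      (flipElem p Z) := Finset.sum_nonneg fun p _ => blockWeight_nonneg hw
  by_cases hZ : NearThreshold B h Z
  · have h1 := sum_blockWeight_flipElem_ge hB hm hZ hw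
    rw [blockWeight, if_pos hZ]
    revert h1
    generalize (fullBlocks B h Z).card = a
    intro h1
    rcases a with _ | _ | a
    · refine le_trans (le_of_eq ?_) h1
      simp [hl]
      ring
    · refine le_trans (le_of_eq ?_) h1
      simp [hl']
    -- Two or more full blocks carry weight zero.
    · simpa using h0
  · rw [blockWeight, if_neg hZ, mul_zero]
    exact h0

end Blocks

/-! ### Edit distance to a unary pattern -/

section Unary

variable {σ : Type}

theorem AlignCost.length_le {X Y : List σ} {c : ℕ} (h : AlignCost X Y c) :
    Y.length ≤ X.length + c := by
  induction h <;> simp only [List.length_cons, List.length_nil] <;> omega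

theorem length_fragment {T : List σ} {i j : ℕ} (hj : j ≤ T.length) :
    (fragment T i j).length = j - i := by
  simp [fragment, hj]

variable [DecidableEq σ] {z : σ}

/-- Every letter of `X` is either paid for or copied onto its own occurrence of `z` in `Y`. -/
theorem AlignCost.length_le_count {X Y : List σ} {c : ℕ} (h : AlignCost X Y c)
    (hX : ∀ a ∈ X, a = z) : X.length ≤ Y.count z + c := by
  induction h with
  | nil => simp
  | delete a _ ih =>
    have := ih fun b hb => hX b (List.mem_cons_of_mem _ hb)
    simp only [List.length_cons]
    omega
  | @insert X Y c b _ ih =>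
    have := ih hX
    have := (List.sublist_cons_self b Y).count_le z
    omega
  | @substitute X Y c a b _ _ ih =>
    have := ih fun b hb => hX b (List.mem_cons_of_mem _ hb)
    have := (List.sublist_cons_self b Y).count_le z
    simp only [List.length_cons]
    omega
  | copy a _ ih =>
    have := ih fun b hb => hX b (List.mem_cons_of_mem _ hb)
    obtain rfl := hX a List.mem_cons_self
    simp only [List.length_cons, List.count_cons_self]
    omega

/-- The position-by-position alignment pays once for each letter other than `z`. -/
theorem exists_alignCost_replicate (z : σ) (Y : List σ) :
    ∃ c, AlignCost (List.replicate Y.length z) Y c ∧ c + Y.count z = Y.length := by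
  induction Y with
  | nil => exact ⟨0, .nil, rfl⟩
  | cons b Y ih =>
    obtain ⟨c, hc, hcY⟩ := ih
    by_cases hb : z = b
    · subst hb
      exact ⟨c, .copy z hc, by simp only [List.count_cons_self, List.length_cons]; omega⟩
    · refine ⟨c + 1, .substitute z b hb hc, ?_⟩
      rw [List.count_cons_of_ne (Ne.symm hb), List.length_cons]
      omega

theorem count_fragment_ofFn {n : ℕ} (T : Fin n → σ) (z : σ) (i j : ℕ) :
    (fragment (List.ofFn T) i j).count z =
      (Finset.univ.filter fun p : Fin n => i ≤ p ∧ (p : ℕ) < j ∧ T p = z).card := by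
  induction n generalizing i j with
  | zero => simp [fragment]
  | succ n ih =>
    rw [List.ofFn_succ, Fin.card_filter_univ_succ]
    cases j with
    | zero => simp [fragment]
    | succ j =>
      cases i with
      | zero =>
        have := ih (fun p => T p.succ) 0 j
        simp only [fragment, List.drop_zero, zero_le, true_and] at this
        by_cases hz : T 0 = z <;> simp [fragment, hz, this]
      | succ i =>
        have := ih (fun p => T p.succ) i j
        simp only [fragment] at this
        simp [fragment, this]

variable {m n k : ℕ} {T : Fin n → σ}

theorem mem_Occ_of_le_card {i : ℕ} (hi : i + m ≤ n)
    (h : m ≤ (Finset.univ.filter fun p : Fin n => i ≤ p ∧ (p : ℕ) < i + m ∧ T p = z).card + k) :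
    i ∈ Occ k (List.ofFn fun _ : Fin m => z) (List.ofFn T) := by
  have hlen : (fragment (List.ofFn T) i (i + m)).length = m := by
    rw [length_fragment (by simpa using hi)]
    omega
  obtain ⟨c, hc, hcY⟩ := exists_alignCost_replicate z (fragment (List.ofFn T) i (i + m))
  rw [hlen] at hc hcY
  rw [count_fragment_ofFn] at hcY
  refine ⟨by simp; omega, i + m, by omega, by simpa using hi, ?_⟩
  rw [List.ofFn_const]
  exact (Nat.sInf_le hc).trans (by omega)

/-- A fragment within distance `k` has length at most `m + k` and lacks at most `k` of the `m`
required letters `z`. -/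
theorem exists_le_card_of_mem_Occ {i : ℕ}
    (h : i ∈ Occ k (List.ofFn fun _ : Fin m => z) (List.ofFn T)) :
    m ≤ (Finset.univ.filter fun p : Fin n =>
      i ≤ p ∧ (p : ℕ) < i + m + k ∧ T p = z).card + k := by
  obtain ⟨-, j, hij, hj, hd⟩ := h
  have ha := alignCost_editDist (List.ofFn fun _ : Fin m => z) (fragment (List.ofFn T) i j)
  have h1 := ha.length_le
  have h2 := ha.length_le_count (z := z) (by simp [List.ofFn_const])
  rw [length_fragment hj, List.length_ofFn] at h1
  rw [count_fragment_ofFn, List.length_ofFn] at h2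
  have h3 : (Finset.univ.filter fun p : Fin n => i ≤ p ∧ (p : ℕ) < j ∧ T p = z).card ≤
      (Finset.univ.filter fun p : Fin n => i ≤ p ∧ (p : ℕ) < i + m + k ∧ T p = z).card := by
    refine Finset.card_le_card fun p hp => ?_
    simp only [Finset.mem_filter, Finset.mem_univ, true_and] at hp ⊢
    exact ⟨hp.1, by omega, hp.2.2⟩
  omega

end Unary

/-! ### Occurrences of a unary pattern in texts made of well-separated blocks -/

section Texts

variable {σ : Type} {n : ℕ}

/-- The text that has `a` exactly at the positions in `Z`, and `b` elsewhere. -/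
def indicatorText (a b : σ) (Z : Finset (Fin n)) (p : Fin n) : σ := if p ∈ Z then a else b

theorem isBinary_indicatorText (a b : σ) (Z : Finset (Fin n)) :
    IsBinary a b (indicatorText a b Z) := fun p => by
  unfold indicatorText
  split_ifs <;> simp

theorem indicatorText_eq_left {a b : σ} (hab : a ≠ b) {Z : Finset (Fin n)} {p : Fin n} :
    indicatorText a b Z p = a ↔ p ∈ Z := by
  unfold indicatorText
  split_ifs with h <;> simp [h, hab.symm]

/-- The positions `3 m j, …, 3 m j + m - 1`. -/
def textBlock (n m j : ℕ) : Finset (Fin n) :=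
  Finset.univ.filter fun p => 3 * m * j ≤ p ∧ (p : ℕ) < 3 * m * j + m

theorem mem_textBlock {m j : ℕ} {p : Fin n} :
    p ∈ textBlock n m j ↔ 3 * m * j ≤ p ∧ (p : ℕ) < 3 * m * j + m := by
  simp [textBlock]

theorem card_textBlock {m j : ℕ} (h : 3 * m * j + m ≤ n) : (textBlock n m j).card = m := by
  have : (textBlock n m j).map Fin.valEmbedding = Finset.Ico (3 * m * j) (3 * m * j + m) := by
    ext p
    simp only [Finset.mem_map, mem_textBlock, Fin.valEmbedding_apply, Finset.mem_Ico]
    exact ⟨fun ⟨q, hq, hqp⟩ => hqp ▸ hq, fun hp => ⟨⟨p, by omega⟩, hp, rfl⟩⟩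
  rw [← Finset.card_map Fin.valEmbedding, this, Nat.card_Ico, Nat.add_sub_cancel_left]

/-- Consecutive blocks are separated by a gap of `2 * m`. Used in both directions, this puts nearby
block positions into the same block. -/
theorem block_index_le {m j j' p q : ℕ} (hp : 3 * m * j ≤ p) (hq : q < 3 * m * j' + m)
    (hpq : p < q + 2 * m) : j ≤ j' := by
  by_contra! h
  have := Nat.mul_le_mul_left (3 * m) (Nat.succ_le_of_lt h)
  rw [Nat.succ_eq_add_one, mul_add] at this
  linarith

theorem pairwise_disjoint_textBlock {N m : ℕ} :
    Pairwise fun j j' : Fin N => Disjoint (textBlock n m j) (textBlock n m j') := by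
  intro j j' hjj
  refine Finset.disjoint_left.mpr fun p hp hp' => hjj ?_
  rw [mem_textBlock] at hp hp'
  have hm : 0 < m := by omega
  exact Fin.ext (le_antisymm (block_index_le hp.1 hp'.2 (by omega))
    (block_index_le hp'.1 hp.2 (by omega)))

variable [DecidableEq σ] {N m k : ℕ} {a b : σ} {Z : Finset (Fin n)}

theorem mem_Occ_of_mem_fullBlocks (hab : a ≠ b) {j : Fin N} (hjn : 3 * m * j + m ≤ n)
    (hj : j ∈ fullBlocks (fun j : Fin N => textBlock n m j) (m - k) Z) :
    3 * m * j ∈ Occ k (List.ofFn fun _ : Fin m => a) (List.ofFn (indicatorText a b Z)) := by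
  refine mem_Occ_of_le_card hjn ?_
  have h1 : (Finset.univ.filter fun p : Fin n => 3 * m * j ≤ p ∧ (p : ℕ) < 3 * m * j + m ∧
      indicatorText a b Z p = a) = Z ∩ textBlock n m j := by
    ext p
    simp only [Finset.mem_filter, Finset.mem_univ, true_and, indicatorText_eq_left hab,
      Finset.mem_inter, mem_textBlock]
    tauto
  rw [mem_fullBlocks] at hj
  rw [h1, hj]
  omega

theorem exists_mem_fullBlocks_of_mem_Occ (hab : a ≠ b) (hk : k < m)
    (hZ : NearThreshold (fun j : Fin N => textBlock n m j) (m - k) Z) {i : ℕ}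
    (hi : i ∈ Occ k (List.ofFn fun _ : Fin m => a) (List.ofFn (indicatorText a b Z))) :
    ∃ j ∈ fullBlocks (fun j : Fin N => textBlock n m j) (m - k) Z,
      3 * m * j < i + 2 * m ∧ i < 3 * m * j + m := by
  have h1 := exists_le_card_of_mem_Occ hi
  simp only [indicatorText_eq_left hab] at h1
  obtain ⟨p, hp⟩ : (Finset.univ.filter fun p : Fin n =>
      i ≤ p ∧ (p : ℕ) < i + m + k ∧ p ∈ Z).Nonempty := by
    rw [← Finset.card_pos]
    omega
  simp only [Finset.mem_filter, Finset.mem_univ, true_and] at hp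
  obtain ⟨j, hj⟩ := hZ.1 p hp.2.2
  have hj' := mem_textBlock.mp hj
  refine ⟨j, ?_, by omega, by omega⟩
  -- The window is shorter than `2 * m` because `k < m`, so all its zeros lie in the block of `p`;
  -- having at least `m - k` of them, that block is full.
  have h2 : (Finset.univ.filter fun p : Fin n => i ≤ p ∧ (p : ℕ) < i + m + k ∧ p ∈ Z) ⊆
      Z ∩ textBlock n m j := by
    intro q hq
    simp only [Finset.mem_filter, Finset.mem_univ, true_and] at hq
    obtain ⟨j', hq'⟩ := hZ.1 q hq.2.2
    have hq'' := mem_textBlock.mp hq'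
    have : j' = j := Fin.ext (le_antisymm (block_index_le hq''.1 hj'.2 (by omega))
      (block_index_le hj'.1 hq''.2 (by omega)))
    subst this
    exact Finset.mem_inter.mpr ⟨hq.2.2, hq'⟩
  have h3 := Finset.card_le_card h2
  have h4 : (Z ∩ textBlock n m j).card = m - k ∨ (Z ∩ textBlock n m j).card + 1 = m - k := hZ.2 j
  rw [mem_fullBlocks]
  omega

theorem mem_Occ_iff_mem_fullBlocks (hab : a ≠ b) (hk : k < m)
    (hZ : NearThreshold (fun j : Fin N => textBlock n m j) (m - k) Z) {j : Fin N}
    (hjn : 3 * m * j + m ≤ n) :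
    3 * m * j ∈ Occ k (List.ofFn fun _ : Fin m => a) (List.ofFn (indicatorText a b Z)) ↔
      j ∈ fullBlocks (fun j : Fin N => textBlock n m j) (m - k) Z := by
  refine ⟨fun h => ?_, mem_Occ_of_mem_fullBlocks hab hjn⟩
  obtain ⟨j', hj', h1, h2⟩ := exists_mem_fullBlocks_of_mem_Occ hab hk hZ h
  have : j = j' := Fin.ext (le_antisymm
    (block_index_le le_rfl h2 (by omega)) (block_index_le le_rfl
      (show 3 * m * (j : ℕ) < 3 * m * j + m by omega) h1))
  exact this ▸ hj'

theorem Occ_nonempty_iff (hab : a ≠ b) (hk : k < m)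
    (hZ : NearThreshold (fun j : Fin N => textBlock n m j) (m - k) Z)
    (hjn : ∀ j : Fin N, 3 * m * j + m ≤ n) :
    (Occ k (List.ofFn fun _ : Fin m => a) (List.ofFn (indicatorText a b Z))).Nonempty ↔
      (fullBlocks (fun j : Fin N => textBlock n m j) (m - k) Z).Nonempty := by
  constructor
  · rintro ⟨i, hi⟩
    obtain ⟨j, hj, -⟩ := exists_mem_fullBlocks_of_mem_Occ hab hk hZ hi
    exact ⟨j, hj⟩
  · rintro ⟨j, hj⟩
    exact ⟨_, mem_Occ_of_mem_fullBlocks hab (hjn j) hj⟩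

end Texts

/-! ### The lower bounds -/

section LowerBounds

variable {n m k : ℕ}

theorem three_mul_add_le_of_lt_div {j : ℕ} (hj : j < (n + 2 * m) / (3 * m)) :
    3 * m * j + m ≤ n := by
  have h1 := Nat.mul_le_mul_left (3 * m) (Nat.succ_le_of_lt hj)
  have h2 := Nat.mul_div_le (n + 2 * m) (3 * m)
  rw [Nat.succ_eq_add_one, mul_add] at h1
  linarith

/-- With `N` for the quotient, maximality gives `n + 2 * m < 3 * m * (N + 1)`, and `N ≥ 1` absorbs
the additive term. -/
theorem div_le_six_mul_div (hmn : m ≤ n) (hm : 0 < m) :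
    (n : ℝ) / m ≤ 6 * ((n + 2 * m) / (3 * m) : ℕ) := by
  have h0 : 1 ≤ (n + 2 * m) / (3 * m) := (Nat.one_le_div_iff (by omega)).mpr (by omega)
  have h1 := Nat.lt_mul_div_succ (n + 2 * m) (show 0 < 3 * m by omega)
  have h2 := Nat.mul_le_mul_left (3 * m) h0
  rw [mul_add] at h1
  rw [div_le_iff₀ (by exact_mod_cast hm)]
  have : n ≤ 6 * ((n + 2 * m) / (3 * m)) * m := by linarith
  exact_mod_cast this

variable {σ : Type} {zero one : σ}

/-- Flipping one position of an indicator text changes only that position of the input. -/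
theorem pmInput_indicatorText_flipElem (p : Fin n) (Z : Finset (Fin n)) (i : Fin m ⊕ Fin n)
    (hi : i ≠ Sum.inr p) :
    pmInput (fun _ => zero) (indicatorText zero one (flipElem p Z)) i =
      pmInput (fun _ => zero) (indicatorText zero one Z) i := by
  rcases i with i | i
  · rfl
  · have hip : i ≠ p := fun h => hi (h ▸ rfl)
    simp [pmInput, indicatorText, mem_flipElem_of_ne hip]

variable [Fintype σ] [DecidableEq σ] [AddCommGroup σ]

theorem reporting_lower_bound (hmn : m ≤ n) (hkm : k < m) (hne : zero ≠ one)
    (A : QueryAlgorithm (Fin m ⊕ Fin n) σ (Set ℕ))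
    (hA : ∀ T : Fin n → σ, IsBinary zero one T → ReportsOcc A k (fun _ => zero) T) :
    ∃ T : Fin n → σ, IsBinary zero one T ∧
      ENNReal.ofReal (1 / 216 * ((n : ℝ) / m * √((k : ℝ) * ((m : ℝ) - k)))) ≤
        (A.queryCount (pmInput (fun _ => zero) T) : ℝ≥0∞) := by
  by_contra! hlt
  obtain ⟨q, hqb, hq⟩ := A.exists_stopsWithin_of_queryCount_lt
    (fun Z : Finset (Fin n) => pmInput (fun _ : Fin m => zero) (indicatorText zero one Z))
    fun Z => hlt _ (isBinary_indicatorText zero one Z)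
  set N := (n + 2 * m) / (3 * m) with hN
  let B : Fin N → Finset (Fin n) := fun j => textBlock n m j
  have hB : Pairwise fun j j' => Disjoint (B j) (B j') := pairwise_disjoint_textBlock
  have hjn : ∀ j : Fin N, 3 * m * j + m ≤ n := fun j => three_mul_add_le_of_lt_div j.2
  have hcard : ∀ j, (B j).card = m := fun j => card_textBlock (hjn j)
  have hh : 0 < m - k := by omega
  have hcast : ((m - k : ℕ) : ℝ) = m - k := Nat.cast_sub hkm.le
  have hmk : (0 : ℝ) < m - k := by
    rw [← hcast]
    exact_mod_cast hh
  have hs : 0 < √((m - k : ℕ) : ℝ) / √((m : ℝ) + 1 - (m - k : ℕ)) := by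
    refine div_pos (Real.sqrt_pos.mpr (by rwa [hcast])) (Real.sqrt_pos.mpr ?_)
    rw [hcast]
    have : (0 : ℝ) ≤ k := k.cast_nonneg
    linarith
  have hbound := A.adversary_bound
    (fun Z : Finset (Fin n) => pmInput (fun _ : Fin m => zero) (indicatorText zero one Z))
    Sum.inr Sum.inr_injective flipElem flipElem_involutive pmInput_indicatorText_flipElem
    (fun Z => Occ k (List.ofFn fun _ : Fin m => zero) (List.ofFn (indicatorText zero one Z)))
    (blockWeight B (m - k) fun a => (√((m - k : ℕ) : ℝ) / √((m : ℝ) + 1 - (m - k : ℕ))) ^ a)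
    (fun Z => blockWeight_nonneg fun a => pow_nonneg hs.le a)
    (by
      obtain ⟨Z, hZ, -⟩ := exists_nearThreshold_fullBlocks_eq_empty (h := m - k) hB hh
        fun j => by rw [hcard]; omega
      refine ⟨Z, ?_⟩
      rw [blockWeight, if_pos hZ]
      exact pow_pos hs _)
    (by
      intro p Z h1 h2 heq
      have hZ := (nearThreshold_of_blockWeight_pos h1).1
      have hZ' := (nearThreshold_of_blockWeight_pos h2).1
      -- The flip toggles whether block `j` is full, hence whether `3 * m * j` is an occurrence.
      obtain ⟨j, hpj, hj⟩ := hZ.flipElem_cases hZ'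
      have e1 := mem_Occ_iff_mem_fullBlocks hne hkm hZ (hjn j)
      have e2 := mem_Occ_iff_mem_fullBlocks hne hkm hZ' (hjn j)
      rw [← heq, e1] at e2
      change j ∈ fullBlocks B _ _ ↔ j ∈ fullBlocks B _ _ at e2
      rcases hj with ⟨hj, hp⟩ | ⟨hj, hp⟩
      · rw [(hZ.flipElem_full hB hpj hp hj).2] at e2
        simp [hj] at e2
      · rw [(hZ.flipElem_not_full hB hpj hp hj).2] at e2
        simp [hj] at e2)
    (mul_blockWeight_pow_le_sum hB hcard hh (Nat.sub_le m k))
    (fun Z => hA _ (isBinary_indicatorText zero one Z)) hq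
  have h1 := div_le_six_mul_div hmn (by omega : 0 < m)
  rw [← hN] at h1
  -- Here `m + 1 - (m - k) = k + 1 ≥ k`. The constant `216` is `36 * 6`: the adversary bound times
  -- the loss in the number of blocks.
  have h2 : √((k : ℝ) * (m - k)) ≤ √(((m - k : ℕ) : ℝ) * ((m : ℝ) + 1 - (m - k : ℕ))) := by
    refine Real.sqrt_le_sqrt ?_
    rw [hcast]
    nlinarith
  have h3 := mul_le_mul h1 h2 (Real.sqrt_nonneg _) (by positivity)
  linarith

theorem decision_lower_bound (hmn : m ≤ n) (hkm : k < m) (hne : zero ≠ one)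
    (A : QueryAlgorithm (Fin m ⊕ Fin n) σ Bool)
    (hA : ∀ T : Fin n → σ, IsBinary zero one T → DecidesOcc A k (fun _ => zero) T) :
    ∃ T : Fin n → σ, IsBinary zero one T ∧
      ENNReal.ofReal (1 / 216 * (√((n : ℝ) / m) * √((k : ℝ) * ((m : ℝ) - k)))) ≤
        (A.queryCount (pmInput (fun _ => zero) T) : ℝ≥0∞) := by
  classical
  by_contra! hlt
  obtain ⟨q, hqb, hq⟩ := A.exists_stopsWithin_of_queryCount_lt
    (fun Z : Finset (Fin n) => pmInput (fun _ : Fin m => zero) (indicatorText zero one Z))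
    fun Z => hlt _ (isBinary_indicatorText zero one Z)
  set N := (n + 2 * m) / (3 * m) with hN
  let B : Fin N → Finset (Fin n) := fun j => textBlock n m j
  have hB : Pairwise fun j j' => Disjoint (B j) (B j') := pairwise_disjoint_textBlock
  have hjn : ∀ j : Fin N, 3 * m * j + m ≤ n := fun j => three_mul_add_le_of_lt_div j.2
  have hcard : ∀ j, (B j).card = m := fun j => card_textBlock (hjn j)
  have hh : 0 < m - k := by omega
  have hcast : ((m - k : ℕ) : ℝ) = m - k := Nat.cast_sub hkm.le
  have hmk : (0 : ℝ) < m - k := by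
    rw [← hcast]
    exact_mod_cast hh
  have hk : (0 : ℝ) < k + 1 := by positivity
  have hN0 : (0 : ℝ) < N := by
    exact_mod_cast (Nat.div_pos (by omega) (by omega) : 0 < (n + 2 * m) / (3 * m))
  have hu := Real.sqrt_pos.mpr hmk
  have hv := Real.sqrt_pos.mpr hk
  have hw := Real.sqrt_pos.mpr hN0
  have hu2 := Real.mul_self_sqrt hmk.le
  have hv2 := Real.mul_self_sqrt hk.le
  have hw2 := Real.mul_self_sqrt hN0.le
  set u := √((m : ℝ) - k)
  set v := √((k : ℝ) + 1)
  set w := √(N : ℝ)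
  -- With `l = w * u * v`, this weight solves `l = N * (k + 1) * s` and `l * s = m - k`.
  have hs : 0 < u / (w * v) := by positivity
  have hbound := A.adversary_bound
    (fun Z : Finset (Fin n) => pmInput (fun _ : Fin m => zero) (indicatorText zero one Z))
    Sum.inr Sum.inr_injective flipElem flipElem_involutive pmInput_indicatorText_flipElem
    (fun Z => decide (Occ k (List.ofFn fun _ : Fin m => zero)
      (List.ofFn (indicatorText zero one Z))).Nonempty)
    (blockWeight B (m - k) fun a => if a = 0 then 1 else if a = 1 then u / (w * v) else 0)
    (fun Z => blockWeight_nonneg fun a => by split_ifs <;> positivity)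
    (by
      obtain ⟨Z, hZ, hZe⟩ := exists_nearThreshold_fullBlocks_eq_empty (h := m - k) hB hh
        fun j => by rw [hcard]; omega
      refine ⟨Z, ?_⟩
      rw [blockWeight, if_pos hZ, hZe]
      simp)
    (by
      intro p Z h1 h2 heq
      obtain ⟨hZ, h1⟩ := nearThreshold_of_blockWeight_pos h1
      obtain ⟨hZ', h2⟩ := nearThreshold_of_blockWeight_pos h2
      -- Positive weight means at most one full block, so a flip moves between zero and one full
      -- blocks and changes the answer.
      have hle : ∀ a : ℕ, 0 < (if a = 0 then 1 else if a = 1 then u / (w * v) else 0 : ℝ) →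
          a ≤ 1 := by
        intro a ha
        by_contra! ha1
        rw [if_neg (by omega), if_neg (by omega)] at ha
        exact lt_irrefl _ ha
      replace h1 := hle _ h1
      replace h2 := hle _ h2
      rw [decide_eq_decide, Occ_nonempty_iff hne hkm hZ hjn, Occ_nonempty_iff hne hkm hZ' hjn,
        ← Finset.card_pos, ← Finset.card_pos] at heq
      change 0 < (fullBlocks B _ _).card ↔ 0 < (fullBlocks B _ _).card at heq
      obtain ⟨j, hpj, ⟨hj, hp⟩ | ⟨hj, hp⟩⟩ := hZ.flipElem_cases hZ'
      · have h3 := Finset.card_erase_add_one hj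
        rw [← (hZ.flipElem_full hB hpj hp hj).2] at h3
        omega
      · have h3 := Finset.card_insert_of_notMem hj
        rw [← (hZ.flipElem_not_full hB hpj hp hj).2] at h3
        omega)
    (l := w * u * v)
    (fun Z => mul_blockWeight_le_one_le_sum hB hcard Z hs.le
      (by
        rw [hcast, ← hw2, show (m : ℝ) + 1 - (m - k) = v * v by rw [hv2]; ring]
        field_simp)
      (by
        rw [hcast, ← hu2]
        field_simp))
    (fun Z => hA _ (isBinary_indicatorText zero one Z)) hq
  have h1 := div_le_six_mul_div hmn (by omega : 0 < m)
  rw [← hN] at h1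
  have h2 : √((k : ℝ) * (m - k)) ≤ u * v := by
    rw [Real.sqrt_le_left (by positivity)]
    nlinarith
  have h3 : √((n : ℝ) / m) ≤ 6 * w := by
    rw [Real.sqrt_le_left (by positivity)]
    nlinarith
  have h4 := mul_le_mul h3 h2 (Real.sqrt_nonneg _) (by positivity)
  linarith

end LowerBounds

theorem mainTheorem4 :
    ∃ c : ℝ, 0 < c ∧
      ∀ (n m k : ℕ), m ≤ n → k < m → 0 < k →
      ∀ (σ : Type) [Fintype σ] [DecidableEq σ] [AddCommGroup σ] (zero one : σ), zero ≠ one →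
        (∀ A : QueryAlgorithm (Fin m ⊕ Fin n) σ (Set ℕ),
          (∀ T : Fin n → σ, IsBinary zero one T → ReportsOcc A k (fun _ => zero) T) →
          ∃ T : Fin n → σ, IsBinary zero one T ∧
            ENNReal.ofReal (c * ((n : ℝ) / m * √((k : ℝ) * ((m : ℝ) - k)))) ≤
              (A.queryCount (pmInput (fun _ => zero) T) : ℝ≥0∞)) ∧
        (∀ A : QueryAlgorithm (Fin m ⊕ Fin n) σ Bool,
          (∀ T : Fin n → σ, IsBinary zero one T → DecidesOcc A k (fun _ => zero) T) →
          ∃ T : Fin n → σ, IsBinary zero one T ∧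
            ENNReal.ofReal (c * (√((n : ℝ) / m) * √((k : ℝ) * ((m : ℝ) - k)))) ≤
              (A.queryCount (pmInput (fun _ => zero) T) : ℝ≥0∞)) := by
  refine ⟨1 / 216, by norm_num, ?_⟩
  intro n m k hmn hkm _ σ _ _ _ zero one hne
  exact ⟨reporting_lower_bound hmn hkm hne, decision_lower_bound hmn hkm hne⟩
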